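/- **Setting.** Let $d\ge 1$, let $\mathcal X=\mathcal X_1\times\dots\times\mathcal X_d$ be a product of measurable spaces with the product $\sigma$-algebra, and write $x_{-i}\in\mathcal X_{-i}$ for $x\in\mathcal X$ with the $i$-th coordinate removed. Let $\pi$ be a probability measure on $\mathcal X$ and, for each $i$, let $\lambda_i$ be a $\sigma$-finite reference measure on $\mathcal X_i$. Assume that the conditional law of $Z_i$ given $Z_{-i}=x_{-i}$, where $Z\sim\pi$, has a regular version $\pi(\cdot\mid x_{-i})$ that for every $x_{-i}$ is a probability measure with a jointly measurable density $\pi(y\mid x_{-i})$ with respect to $\lambda_i$; fix such a version. For each $i$ let $q_{x_{-i}}(x_i,y)$ be a jointly measurable proposal density with respect to $\lambda_i$, with $\int q_{x_{-i}}(x_i,y)\,\lambda_i(dy)=1$, and set $Q_{x_{-i}}(x_i,dy)=q_{x_{-i}}(x_i,y)\,\lambda_i(dy)$. Let $P_{x_{-i}}$ be the Metropolis–Hastings kernel on $\mathcal X_i$ that from $x_i$ proposes $Y\sim Q_{x_{-i}}(x_i,\cdot)$ and accepts it with probability $$\min\Big(1,\frac{\pi(Y\mid x_{-i})\,q_{x_{-i}}(Y,x_i)}{\pi(x_i\mid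 x_{-i})\,q_{x_{-i}}(x_i,Y)}\Big)$$ (read as $1$ where the denominator vanishes), and otherwise stays at $x_i$. Let $0<\varepsilon\le 1/d$ and $\mathcal Y=[\varepsilon,1]^d\cap\{p\in\mathbb R^d: p_i\ge 0,\ \sum_i p_i=1\}$. For $\alpha\in\mathcal Y$, the random scan Gibbs sampler RSG($\alpha$) is the Markov chain that chooses coordinate $i$ with probability $\alpha_i$ and replaces $x_i$ by a draw from $\pi(\cdot\mid x_{-i})$. The adaptive random scan Metropolis-within-Gibbs sampler (AdapRSMwG), with measurable update functions $R_n$ and starting values $X_0=x_0\in\mathcal X$, $\alpha_0\in\mathcal Y$, at each step $n\ge1$ sets $\alpha_n=R_n(\alpha_0,\dots,\alpha_{n-1},X_{n-1},\dots,X_0)\in\mathcal Y$, chooses $i$ with probability $\alpha_{n,i}$, and replaces the $i$-th coordinate of $X_{n-1}$ by a draw from $P_{X_{n-1,-i}}(X_{n-1,i},\cdot)$, which gives $X_n$. Let $\mathbb P_{x_0,\alpha_0}$ be the law of $(\alpha_n,X_n)_{n\ge0}$, and let $T(x_0,\alpha_0,n)=\sup_B|\mathbb P_{x_0,\alpha_0}(X_n\in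 B)-\pi(B)|$ be the total variation distance between the law of $X_n$ and $\pi$. A kernel $P$ is called uniformly ergodic with limit $\mu$ if there are $M<\infty$ and $0\le\rho<1$ with $\|P^n(x,\cdot)-\mu\|_{TV}\le M\rho^n$ for all $x$ and $n$. **Theorem.** Assume that * there is $\beta\in\mathcal Y$ such that RSG($\beta$) is uniformly ergodic with limit $\pi$; * for every $i$, the kernel $P_{x_{-i}}$ is uniformly ergodic with limit $\pi(\cdot\mid x_{-i})$ for every $x_{-i}\in\mathcal X_{-i}$, and there are $s_i>0$ and a nonnegative integer $m_i$ such that for every $x_{-i}$ there is a probability measure $\nu_{x_{-i}}$ on $\mathcal X_i$ with $P_{x_{-i}}^{m_i}(x_i,\cdot)\ge s_i\,\nu_{x_{-i}}(\cdot)$ for all $x_i\in\mathcal X_i$. Then: 1. For all $x_0\in\mathcal X$, $\alpha_0\in\mathcal Y$: if $|\alpha_n-\alpha_{n-1}|\to0$ in probability under $\mathbb P_{x_0,\alpha_0}$, then $T(x_0,\alpha_0,n)\to0$ as $n\to\infty$. In particular, if this diminishing adaptation holds for $\pi$-almost every $x_0$ and all $\alpha_0\in\mathcal Y$, then AdapRSMwG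 is ergodic, i.e. $T(x_0,\alpha_0,n)\to0$ for $\pi$-almost every $x_0$ and all $\alpha_0\in\mathcal Y$. 2. If the adaptation diminishes uniformly, i.e. $\sup_{x_0,\alpha_0}\mathbb P_{x_0,\alpha_0}(|\alpha_n-\alpha_{n-1}|\ge\delta)\to0$ as $n\to\infty$ for every $\delta>0$, then $\sup_{x_0,\alpha_0}T(x_0,\alpha_0,n)\to0$ as $n\to\infty$. -/

import Mathlib

open MeasureTheory ProbabilityTheory Filter Topology
open scoped NNReal ENNReal

universe u

namespace AdaptiveGibbs

noncomputable section

/-- Total variation distance `sup_B |μ B - ν B|` (used for probability measures). -/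
def tvDist {E : Type*} [MeasurableSpace E] (μ ν : Measure E) : ℝ :=
  ⨆ B : {B : Set E // MeasurableSet B}, |μ.real B - ν.real B|

/-- A Markov chain with transition kernel `P` is uniformly ergodic with limit `π`
(`P ^ n` is the `n`-fold composition of the kernel `P`). -/
def UniformlyErgodic {E : Type*} [MeasurableSpace E] (P : Kernel E E) (π : Measure E) : Prop :=
  ∃ M ρ : ℝ, 0 ≤ ρ ∧ ρ < 1 ∧ ∀ (x : E) (n : ℕ), tvDist ((P ^ n) x) π ≤ M * ρ ^ n

/-- The set `𝒴 = [ε, 1]^d ∩ Δ_{d-1}` of admissible selection probabilities. -/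
def selectionSet (d : ℕ) (ε : ℝ) : Set (Fin d → ℝ) :=
  {a | ∀ i, a i ∈ Set.Icc ε 1} ∩ stdSimplex ℝ (Fin d)

/-- The space `𝒳_{-i}` of all coordinates but the `i`-th. -/
abbrev Others {d : ℕ} (X : Fin d → Type u) (i : Fin d) : Type u :=
  ∀ j : {j : Fin d // j ≠ i}, X j

/-- `x ↦ x_{-i}`. -/
def dropCoord {d : ℕ} {X : Fin d → Type u} (i : Fin d) (x : ∀ j, X j) : Others X i :=
  fun j => x j

/-- The kernel `b ↦ f b y μ(dy)`. -/
def densityKernel {α β : Type*} [MeasurableSpace α] [MeasurableSpace β] (μ : Measure α)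
    [SFinite μ] (f : β → α → ℝ≥0) : Kernel β α :=
  (Kernel.const β μ).withDensity (fun b y => (f b y : ℝ≥0∞))

/-- The target and the proposals of a Metropolis-within-Gibbs sampler on `X 0 × ⋯ × X (d - 1)`. -/
structure Setting {d : ℕ} (X : Fin d → Type u) [∀ i, MeasurableSpace (X i)] where
  /-- The target distribution `π`. -/
  target : Measure (∀ i, X i)
  isProbabilityMeasure_target : IsProbabilityMeasure target
  /-- The reference measure on the `i`-th coordinate, with respect to which densities are taken. -/
  ref : ∀ i, Measure (X i)
  sigmaFinite_ref : ∀ i, SigmaFinite (ref i)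
  /-- The conditional density `π(y | x_{-i})`. -/
  condDens : ∀ i, Others X i → X i → ℝ≥0
  measurable_condDens : ∀ i, Measurable (fun w : Others X i × X i => condDens i w.1 w.2)
  lintegral_condDens : ∀ i z, ∫⁻ y, (condDens i z y : ℝ≥0∞) ∂(ref i) = 1
  /-- `π(y | x_{-i}) dy` is a regular version of the law of `Z_i` given `Z_{-i} = x_{-i}`,
  where `Z ∼ π`. -/
  isCondKernel : ∀ i, (target.map (fun x => (dropCoord i x, x i))).IsCondKernel
    (densityKernel (ref i) (condDens i))
  /-- The proposal density `q_{x_{-i}}(x_i, y)`. -/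
  propDens : ∀ i, Others X i → X i → X i → ℝ≥0
  measurable_propDens : ∀ i,
    Measurable (fun w : (Others X i × X i) × X i => propDens i w.1.1 w.1.2 w.2)
  lintegral_propDens : ∀ i z x, ∫⁻ y, (propDens i z x y : ℝ≥0∞) ∂(ref i) = 1

theorem measurable_dropCoord {d : ℕ} {X : Fin d → Type u} [∀ i, MeasurableSpace (X i)]
    (i : Fin d) : Measurable (dropCoord (X := X) i) :=
  measurable_pi_lambda _ fun j => measurable_pi_apply (j : Fin d)

/-- The kernel on the product space that replaces the `i`-th coordinate of `x` by a draw
from `K x`. -/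
def updateCoord {d : ℕ} {X : Fin d → Type u} [∀ i, MeasurableSpace (X i)] (i : Fin d)
    (K : Kernel (∀ j, X j) (X i)) : Kernel (∀ j, X j) (∀ j, X j) :=
  (Kernel.id ×ₖ K).map (fun w => Function.update w.1 i w.2)

instance isMarkovKernel_updateCoord {d : ℕ} {X : Fin d → Type u} [∀ i, MeasurableSpace (X i)]
    (i : Fin d) (K : Kernel (∀ j, X j) (X i)) [IsMarkovKernel K] :
    IsMarkovKernel (updateCoord i K) :=
  Kernel.IsMarkovKernel.map _ measurable_update'

/-- The kernel `(α, x) ↦ α i • P x`. -/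
def weighted {d : ℕ} {ε : ℝ} {E : Type*} [MeasurableSpace E] (i : Fin d) (P : Kernel E E)
    [IsMarkovKernel P] : Kernel (selectionSet d ε × E) E :=
  (P.comap Prod.snd measurable_snd).withDensity
    (fun w _ => ENNReal.ofReal ((w.1 : Fin d → ℝ) i))

/-- The mixture `(α, x) ↦ ∑ i, α i • P i x`: choose `i` with probability `α i`, then move
according to `P i`. -/
def mixture {d : ℕ} {ε : ℝ} {E : Type*} [MeasurableSpace E] (P : Fin d → Kernel E E)
    [∀ i, IsMarkovKernel (P i)] : Kernel (selectionSet d ε × E) E :=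
  ∑ i, weighted i (P i)

theorem weighted_apply {d : ℕ} {ε : ℝ} {E : Type*} [MeasurableSpace E] (i : Fin d)
    (P : Kernel E E) [IsMarkovKernel P] (w : selectionSet d ε × E) :
    weighted i P w = ENNReal.ofReal ((w.1 : Fin d → ℝ) i) • P w.2 := by
  have h : Measurable (Function.uncurry (fun (w : selectionSet d ε × E) (_ : E) =>
      ENNReal.ofReal ((w.1 : Fin d → ℝ) i))) :=
    ENNReal.measurable_ofReal.comp ((measurable_pi_apply i).comp
      (measurable_subtype_coe.comp (measurable_fst.comp measurable_fst)))
  rw [weighted, Kernel.withDensity_apply _ h, withDensity_const, Kernel.comap_apply]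

instance isMarkovKernel_mixture {d : ℕ} {ε : ℝ} {E : Type*} [MeasurableSpace E]
    (P : Fin d → Kernel E E) [∀ i, IsMarkovKernel (P i)] :
    IsMarkovKernel (mixture (ε := ε) P) := by
  refine ⟨fun w => ⟨?_⟩⟩
  rw [mixture, sum_apply, Measure.finsetSum_apply]
  simp only [weighted_apply, Measure.smul_apply, measure_univ, smul_eq_mul, mul_one]
  rw [← ENNReal.ofReal_sum_of_nonneg fun i _ => w.1.2.2.1 i, w.1.2.2.2, ENNReal.ofReal_one]

/-- The kernel `P_α = ∑ i, α i • P i` for fixed selection probabilities `α`. -/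
def randomScan {d : ℕ} {ε : ℝ} {E : Type*} [MeasurableSpace E] (P : Fin d → Kernel E E)
    [∀ i, IsMarkovKernel (P i)] (α : selectionSet d ε) : Kernel E E :=
  (mixture P).comap (fun x => (α, x)) measurable_prodMk_left

namespace Setting

variable {d : ℕ} {X : Fin d → Type u} [∀ i, MeasurableSpace (X i)] (S : Setting X)

instance : IsProbabilityMeasure S.target := S.isProbabilityMeasure_target

instance (i : Fin d) : SigmaFinite (S.ref i) := S.sigmaFinite_ref i

/-- The full conditional `x_{-i} ↦ π(· | x_{-i})`. -/
def cond (i : Fin d) : Kernel (Others X i) (X i) :=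
  densityKernel (S.ref i) (S.condDens i)

/-- The proposal kernel `(x_{-i}, x_i) ↦ Q_{x_{-i}}(x_i, ·)`. -/
def proposal (i : Fin d) : Kernel (Others X i × X i) (X i) :=
  densityKernel (S.ref i) (fun w y => S.propDens i w.1 w.2 y)

/-- The Metropolis–Hastings acceptance probability of the move from `x` to `y`, equal to `1` where
the denominator vanishes. -/
def acceptProb (i : Fin d) (z : Others X i) (x y : X i) : ℝ≥0 :=
  if S.condDens i z x * S.propDens i z x y = 0 then 1
  else min 1 ((S.condDens i z y * S.propDens i z y x) / (S.condDens i z x * S.propDens i z x y))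

instance isMarkovKernel_cond (i : Fin d) : IsMarkovKernel (S.cond i) := by
  refine ⟨fun z => ⟨?_⟩⟩
  rw [cond, densityKernel, Kernel.withDensity_apply' _ (S.measurable_condDens i).coe_nnreal_ennreal]
  simpa using S.lintegral_condDens i z

instance isMarkovKernel_proposal (i : Fin d) : IsMarkovKernel (S.proposal i) := by
  refine ⟨fun w => ⟨?_⟩⟩
  rw [proposal, densityKernel,
    Kernel.withDensity_apply' _ (S.measurable_propDens i).coe_nnreal_ennreal]
  simpa using S.lintegral_propDens i w.1 w.2

/-- The Metropolis kernel `(x_{-i}, x_i) ↦ P_{x_{-i}}(x_i, ·)`: a proposal `Y` is accepted with the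
acceptance probability, otherwise the coordinate stays at `x_i`. -/
def metropolis (i : Fin d) : Kernel (Others X i × X i) (X i) :=
  (S.proposal i).withDensity (fun w y => (S.acceptProb i w.1 w.2 y : ℝ≥0∞)) +
  (Kernel.deterministic Prod.snd measurable_snd).withDensity
    (fun w _ => ∫⁻ y, (1 - S.acceptProb i w.1 w.2 y : ℝ≥0∞) ∂(S.proposal i w))

theorem measurable_acceptProb (i : Fin d) : Measurable
    (fun w : (Others X i × X i) × X i => S.acceptProb i w.1.1 w.1.2 w.2) := by
  have hp := S.measurable_condDens i
  have hq := S.measurable_propDens i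
  have h1 : Measurable (fun w : (Others X i × X i) × X i =>
      S.condDens i w.1.1 w.1.2 * S.propDens i w.1.1 w.1.2 w.2) :=
    (hp.comp measurable_fst).mul hq
  have h2 : Measurable (fun w : (Others X i × X i) × X i =>
      S.condDens i w.1.1 w.2 * S.propDens i w.1.1 w.2 w.1.2) :=
    (hp.comp (f := fun w : (Others X i × X i) × X i => (w.1.1, w.2)) (by fun_prop)).mul
      (hq.comp (f := fun w : (Others X i × X i) × X i => ((w.1.1, w.2), w.1.2)) (by fun_prop))
  exact Measurable.ite (h1 (measurableSet_singleton 0)) measurable_const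
    (measurable_const.min (h2.div h1))

theorem acceptProb_le_one (i : Fin d) (z : Others X i) (x y : X i) :
    S.acceptProb i z x y ≤ 1 := by
  unfold acceptProb
  split_ifs
  · exact le_rfl
  · exact min_le_left _ _

theorem measurable_reject (i : Fin d) : Measurable (Function.uncurry
    (fun (w : Others X i × X i) (_ : X i) =>
      ∫⁻ y, (1 - S.acceptProb i w.1 w.2 y : ℝ≥0∞) ∂(S.proposal i w))) := by
  have h : Measurable (fun w : Others X i × X i =>
      ∫⁻ y, (1 - S.acceptProb i w.1 w.2 y : ℝ≥0∞) ∂(S.proposal i w)) :=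
    Measurable.lintegral_kernel_prod_right
      (measurable_const.sub (S.measurable_acceptProb i).coe_nnreal_ennreal)
  exact h.comp measurable_fst

instance isMarkovKernel_metropolis (i : Fin d) : IsMarkovKernel (S.metropolis i) := by
  refine ⟨fun w => ⟨?_⟩⟩
  have ha := (S.measurable_acceptProb i).coe_nnreal_ennreal
  rw [metropolis, FunLike.coe_add, Pi.add_apply, Measure.add_apply,
    Kernel.withDensity_apply' _ ha, Kernel.withDensity_apply' _ (S.measurable_reject i)]
  simp only [Measure.restrict_univ, lintegral_const, measure_univ, mul_one]
  have ha' : Measurable (fun y => (S.acceptProb i w.1 w.2 y : ℝ≥0∞)) :=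
    ha.comp measurable_prodMk_left
  rw [← lintegral_add_left ha']
  have h (y : X i) : (S.acceptProb i w.1 w.2 y : ℝ≥0∞) + (1 - S.acceptProb i w.1 w.2 y) = 1 :=
    add_tsub_cancel_of_le (by exact_mod_cast S.acceptProb_le_one i w.1 w.2 y)
  simp [h]

/-- The Metropolis kernel `P_{x_{-i}}` on `X i` for fixed `x_{-i} = z`. -/
def metropolisAt (i : Fin d) (z : Others X i) : Kernel (X i) (X i) :=
  (S.metropolis i).comap (fun x => (z, x)) measurable_prodMk_left

/-- The Gibbs update of the `i`-th coordinate. -/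
def gibbsStep (i : Fin d) : Kernel (∀ j, X j) (∀ j, X j) :=
  updateCoord i ((S.cond i).comap (dropCoord i) (measurable_dropCoord i))

/-- The Metropolis update of the `i`-th coordinate. -/
def metropolisStep (i : Fin d) : Kernel (∀ j, X j) (∀ j, X j) :=
  updateCoord i ((S.metropolis i).comap (fun x => (dropCoord i x, x i))
    ((measurable_dropCoord i).prodMk (measurable_pi_apply i)))

instance (i : Fin d) : IsMarkovKernel (S.gibbsStep i) := by unfold gibbsStep; infer_instance

instance (i : Fin d) : IsMarkovKernel (S.metropolisStep i) := by
  unfold metropolisStep; infer_instance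

/-- The kernel of the random scan Gibbs sampler `RSG(α)`. -/
def rsg {ε : ℝ} (α : selectionSet d ε) : Kernel (∀ j, X j) (∀ j, X j) :=
  randomScan S.gibbsStep α

/-- Uniform ergodicity of the Metropolis kernels and a minorisation whose constants do not depend
on the remaining coordinates. -/
def MetropolisMinorised : Prop :=
  ∀ i, (∀ z, UniformlyErgodic (S.metropolisAt i z) (S.cond i z)) ∧
    ∃ (s : ℝ≥0) (m : ℕ), 0 < s ∧ ∀ z, ∃ ν : Measure (X i), IsProbabilityMeasure ν ∧
      ∀ x, s • ν ≤ (S.metropolisAt i z ^ m) x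

end Setting

/-- The histories `((α_0, x_0), …, (α_n, x_n))`. -/
abbrev History {d : ℕ} (ε : ℝ) (X : Fin d → Type u) (n : ℕ) : Type u :=
  Finset.Iic n → selectionSet d ε × (∀ j, X j)

/-- An update rule: `R n` computes `α_{n+1}` from `(α_0, x_0), …, (α_n, x_n)`. -/
structure UpdateRule {d : ℕ} (ε : ℝ) (X : Fin d → Type u) [∀ i, MeasurableSpace (X i)] where
  /-- The update function. -/
  toFun : ∀ n : ℕ, History ε X n → selectionSet d ε
  measurable_toFun : ∀ n, Measurable (toFun n)

namespace Setting

variable {d : ℕ} {X : Fin d → Type u} [∀ i, MeasurableSpace (X i)] (S : Setting X)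
  {ε : ℝ} (R : UpdateRule ε X)

/-- One step of the adaptive random scan Metropolis-within-Gibbs sampler: given the history up to
time `n`, set `α_{n+1}` by the update rule, then draw `x_{n+1}` by a random scan Metropolis step
from `x_n` with selection probabilities `α_{n+1}`. -/
def adapStep (n : ℕ) : Kernel (History ε X n) (selectionSet d ε × (∀ j, X j)) :=
  ((Kernel.deterministic Prod.fst measurable_fst) ×ₖ (mixture S.metropolisStep)).comap
    (fun h => (R.toFun n h, (h ⟨n, Finset.mem_Iic.2 le_rfl⟩).2))
    ((R.measurable_toFun n).prodMk (measurable_snd.comp (measurable_pi_apply _)))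

instance (n : ℕ) : IsMarkovKernel (S.adapStep R n) := by unfold adapStep; infer_instance

/-- The law of the whole trajectory `((α_n, X_n))_n` of the adaptive sampler started at
`(α_0, x_0)`. -/
def adapLaw (x₀ : ∀ j, X j) (α₀ : selectionSet d ε) :
    Measure (ℕ → selectionSet d ε × (∀ j, X j)) :=
  Kernel.traj (X := fun _ => selectionSet d ε × (∀ j, X j)) (S.adapStep R) 0 (fun _ => (α₀, x₀))

/-- `T(x_0, α_0, n)`, the total variation distance between the law of `X_n` and the target. -/
def tvToTarget (x₀ : ∀ j, X j) (α₀ : selectionSet d ε) (n : ℕ) : ℝ :=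
  tvDist ((S.adapLaw R x₀ α₀).map (fun ω => (ω n).2)) S.target

/-- The sampler is ergodic: `T(x_0, α_0, n) → 0` for `π`-almost all `x_0` and all `α_0`. -/
def Ergodic : Prop :=
  ∀ᵐ x₀ ∂S.target, ∀ α₀, Tendsto (S.tvToTarget R x₀ α₀) atTop (𝓝 0)

/-- The increment `|α_{n+1} - α_n|` along a trajectory. -/
def increment {d : ℕ} {X : Fin d → Type u} {ε : ℝ} (n : ℕ)
    (ω : ℕ → selectionSet d ε × (∀ j, X j)) : ℝ :=
  ‖((ω (n + 1)).1 : Fin d → ℝ) - ((ω n).1 : Fin d → ℝ)‖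

/-- `|α_n - α_{n-1}| → 0` in probability, for the starting values `x_0`, `α_0`. -/
def DiminishingFrom (x₀ : ∀ j, X j) (α₀ : selectionSet d ε) : Prop :=
  TendstoInMeasure (S.adapLaw R x₀ α₀) increment atTop (fun _ => 0)

/-- `|α_n - α_{n-1}| → 0` in probability, uniformly in the starting values. -/
def UniformlyDiminishing : Prop :=
  ∀ δ : ℝ, 0 < δ → Tendsto
    (fun n => ⨆ (x₀ : ∀ j, X j) (α₀ : selectionSet d ε),
      S.adapLaw R x₀ α₀ {ω | δ ≤ increment n ω}) atTop (𝓝 0)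

end Setting

end

end AdaptiveGibbs

/-! Write `P_α` for the random scan Metropolis kernel with fixed selection probabilities `α`. The
proof combines convergence of `P_α ^ K` to the target, uniform in `α` and in the starting point
(`exists_pow_randomScan_close`), with a comparison over a window of `K` steps between the adaptive
chain and the chain whose `α` is frozen at the start of the window (`abs_integral_sub_frozen_le`).

Uniform convergence: since `s` and `m` do not depend on `x_{-i}`, some power `N` of each Metropolis
update is uniformly close to the Gibbs update. Hence the `β`-mixture of these `N`-th powers, run `k`
times, stays close to `k` steps of RSG(`β`), and so to the constant kernel `π`. Every `α` gives each
coordinate probability at least `ε`, so `P_α ^ (N * k)` dominates `ε ^ (N * k)` times that almost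
constant kernel. This approximate Doeblin condition contracts oscillations by a factor free of `α`.

Comparison: exchanging one frozen step for an adaptive one costs at most `d` times the expected
drift of `α` since the window began, which diminishing adaptation makes small for fixed `K`. As `K`
and the required smallness do not depend on the starting values, the pointwise and the uniform
statements follow alike. -/

namespace AdaptiveGibbs

/-! ### Test functions and total variation. -/

section General

variable {E F : Type*} [MeasurableSpace E] [MeasurableSpace F]

/-- Measurable functions with values in `[0, 1]`, the test functions for total variation. -/
structure UnitValued (f : E → ℝ) : Prop where
  measurable : Measurable f
  nonneg : ∀ x, 0 ≤ f x
  le_one : ∀ x, f x ≤ 1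

namespace UnitValued

variable {f : E → ℝ}

theorem integrable (hf : UnitValued f) (μ : Measure E) [IsFiniteMeasure μ] : Integrable f μ :=
  Integrable.of_bound hf.measurable.aestronglyMeasurable 1
    (ae_of_all _ fun x => by rw [Real.norm_of_nonneg (hf.nonneg x)]; exact hf.le_one x)

theorem comp (hf : UnitValued f) {g : F → E} (hg : Measurable g) :
    UnitValued (fun y => f (g y)) :=
  ⟨hf.measurable.comp hg, fun y => hf.nonneg (g y), fun y => hf.le_one (g y)⟩

theorem one_sub (hf : UnitValued f) : UnitValued (fun x => 1 - f x) :=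
  ⟨measurable_const.sub hf.measurable, fun x => sub_nonneg.2 (hf.le_one x),
    fun x => sub_le_self _ (hf.nonneg x)⟩

theorem indicator {B : Set E} (hB : MeasurableSet B) :
    UnitValued (B.indicator (fun _ => (1 : ℝ))) :=
  ⟨measurable_const.indicator hB, fun x => Set.indicator_nonneg (fun _ _ => zero_le_one) x,
    fun x => Set.indicator_le_self' (fun _ _ => zero_le_one) x⟩

theorem integral_nonneg (hf : UnitValued f) (μ : Measure E) : 0 ≤ ∫ x, f x ∂μ :=
  MeasureTheory.integral_nonneg hf.nonneg

theorem integral_le_one (hf : UnitValued f) (μ : Measure E) [IsProbabilityMeasure μ] :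
    ∫ x, f x ∂μ ≤ 1 := by
  simpa using integral_mono (hf.integrable μ) (integrable_const (1 : ℝ)) hf.le_one

theorem integral_one_sub (hf : UnitValued f) (μ : Measure E) [IsProbabilityMeasure μ] :
    ∫ x, (1 - f x) ∂μ = 1 - ∫ x, f x ∂μ := by
  rw [integral_sub (integrable_const _) (hf.integrable μ)]; simp

theorem integral_kernel_prod {g : F × E → ℝ} (hg : UnitValued g) (K : Kernel F E)
    [IsMarkovKernel K] : UnitValued (fun x => ∫ y, g (x, y) ∂(K x)) :=
  ⟨(hg.measurable.stronglyMeasurable.integral_kernel_prod_right' (κ := K)).measurable,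
    fun _ => (hg.comp measurable_prodMk_left).integral_nonneg _,
    fun _ => (hg.comp measurable_prodMk_left).integral_le_one _⟩

theorem integral_kernel (hf : UnitValued f) (K : Kernel F E) [IsMarkovKernel K] :
    UnitValued (fun x => ∫ y, f y ∂(K x)) :=
  integral_kernel_prod (g := fun w => f w.2) (hf.comp measurable_snd) K

end UnitValued

theorem abs_measureReal_sub_le_one (μ ν : Measure E) [IsProbabilityMeasure μ]
    [IsProbabilityMeasure ν] (B : Set E) : |μ.real B - ν.real B| ≤ 1 := by
  have h1 : μ.real B ≤ 1 := measureReal_le_one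
  have h2 : ν.real B ≤ 1 := measureReal_le_one
  have h3 : 0 ≤ μ.real B := measureReal_nonneg
  have h4 : 0 ≤ ν.real B := measureReal_nonneg
  rw [abs_le]
  constructor <;> linarith

theorem abs_measureReal_sub_le_tvDist (μ ν : Measure E) [IsProbabilityMeasure μ]
    [IsProbabilityMeasure ν] {B : Set E} (hB : MeasurableSet B) :
    |μ.real B - ν.real B| ≤ tvDist μ ν :=
  le_ciSup (f := fun B : {B : Set E // MeasurableSet B} => |μ.real B - ν.real B|)
    ⟨1, by rintro _ ⟨B, rfl⟩; exact abs_measureReal_sub_le_one μ ν B⟩ ⟨B, hB⟩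

theorem tvDist_nonneg (μ ν : Measure E) : 0 ≤ tvDist μ ν :=
  Real.iSup_nonneg fun _ => abs_nonneg _

/-- By the layer-cake formula, the integral of `f` is the average over `t ∈ (0, 1]` of the measures
of `{t ≤ f}`, and each level set contributes at most `tvDist μ ν`. -/
theorem abs_integral_sub_le_tvDist (μ ν : Measure E) [IsProbabilityMeasure μ]
    [IsProbabilityMeasure ν] {f : E → ℝ} (hf : UnitValued f) :
    |∫ x, f x ∂μ - ∫ x, f x ∂ν| ≤ tvDist μ ν := by
  have layer (ρ : Measure E) [IsProbabilityMeasure ρ] :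
      ∫ x, f x ∂ρ = ∫ t in Set.Ioc (0 : ℝ) 1, ρ.real {a | t ≤ f a} :=
    (hf.integrable ρ).integral_eq_integral_Ioc_meas_le (ae_of_all _ hf.nonneg)
      (ae_of_all _ hf.le_one)
  have hint (ρ : Measure E) [IsProbabilityMeasure ρ] :
      IntegrableOn (fun t : ℝ => ρ.real {a | t ≤ f a}) (Set.Ioc 0 1) := by
    have hanti : Antitone (fun t : ℝ => ρ.real {a | t ≤ f a}) := fun s t hst =>
      measureReal_mono fun a (ha : t ≤ f a) => hst.trans ha
    refine Integrable.of_bound hanti.measurable.aestronglyMeasurable 1 (ae_of_all _ fun t => ?_)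
    rw [Real.norm_of_nonneg measureReal_nonneg]
    exact measureReal_le_one
  rw [layer μ, layer ν, ← integral_sub (hint μ) (hint ν), ← Real.norm_eq_abs]
  have h := norm_setIntegral_le_of_norm_le_const (μ := volume) (s := Set.Ioc (0 : ℝ) 1)
    (f := fun t : ℝ => μ.real {a | t ≤ f a} - ν.real {a | t ≤ f a}) (C := tvDist μ ν)
    (by simp) (fun t _ => abs_measureReal_sub_le_tvDist μ ν
      (measurableSet_le measurable_const hf.measurable))
  simpa using h

theorem tvDist_le_of_forall_unitValued {μ ν : Measure E} {r : ℝ} (hr : 0 ≤ r)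
    (h : ∀ f, UnitValued f → |∫ x, f x ∂μ - ∫ x, f x ∂ν| ≤ r) : tvDist μ ν ≤ r := by
  refine Real.iSup_le (fun B => ?_) hr
  simpa [integral_indicator_const _ B.2] using h _ (UnitValued.indicator B.2)

theorem abs_sub_le_add_of_le {a b c r s : ℝ} (h : |a - b| ≤ r) (h' : |b - c| ≤ s) :
    |a - c| ≤ r + s :=
  (abs_sub_le a b c).trans (add_le_add h h')

theorem abs_integral_sub_integral_le (μ : Measure E) [IsProbabilityMeasure μ] {f g : E → ℝ}
    (hf : UnitValued f) (hg : UnitValued g) {r : ℝ} (h : ∀ x, |f x - g x| ≤ r) :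
    |∫ x, f x ∂μ - ∫ x, g x ∂μ| ≤ r := by
  rw [← integral_sub (hf.integrable μ) (hg.integrable μ), ← Real.norm_eq_abs]
  simpa using norm_integral_le_of_norm_le_const (μ := μ) (f := fun x => f x - g x) (ae_of_all _ h)

theorem abs_integral_sub_const_le (μ : Measure E) [IsProbabilityMeasure μ] {f : E → ℝ}
    (hf : UnitValued f) {a r : ℝ} (h : ∀ x, |f x - a| ≤ r) : |∫ x, f x ∂μ - a| ≤ r := by
  have h1 : ∫ x, (f x - a) ∂μ = ∫ x, f x ∂μ - a := by
    rw [integral_sub (hf.integrable μ) (integrable_const _)]; simp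
  rw [← h1, ← Real.norm_eq_abs]
  simpa using norm_integral_le_of_norm_le_const (μ := μ) (f := fun x => f x - a) (ae_of_all _ h)

/-! ### Powers, domination and contraction of Markov kernels. -/

section Kernels

instance isMarkovKernel_pow (K : Kernel E E) [IsMarkovKernel K] (n : ℕ) :
    IsMarkovKernel (K ^ n) := by
  induction n with
  | zero => rw [pow_zero]; exact inferInstanceAs (IsMarkovKernel Kernel.id)
  | succ n ih => rw [pow_succ]; exact inferInstanceAs (IsMarkovKernel ((K ^ n) ∘ₖ K))

theorem integral_pow_zero (K : Kernel E E) {f : E → ℝ} (hf : UnitValued f) (x : E) :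
    ∫ y, f y ∂((K ^ 0) x) = f x := by
  rw [pow_zero]
  change ∫ y, f y ∂(Kernel.id x) = f x
  rw [Kernel.id_apply, integral_dirac' _ _ hf.measurable.stronglyMeasurable]

theorem integral_pow_add (K : Kernel E E) [IsMarkovKernel K] {f : E → ℝ} (hf : UnitValued f)
    (m n : ℕ) (x : E) :
    ∫ y, f y ∂((K ^ (m + n)) x) = ∫ y, ∫ w, f w ∂((K ^ n) y) ∂((K ^ m) x) := by
  -- In a composition the right factor runs first, so the `m` initial steps must stand on the right.
  rw [add_comm, Kernel.pow_add, Kernel.integral_comp (hf.integrable _)]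

theorem integral_pow_succ (K : Kernel E E) [IsMarkovKernel K] {f : E → ℝ} (hf : UnitValued f)
    (n : ℕ) (x : E) :
    ∫ y, f y ∂((K ^ (n + 1)) x) = ∫ y, ∫ w, f w ∂((K ^ n) y) ∂(K x) := by
  rw [add_comm, integral_pow_add K hf, pow_one]

/-- `π` is invariant for `K`, in terms of test functions. -/
def Preserves (K : Kernel E E) (π : Measure E) : Prop :=
  ∀ f, UnitValued f → ∫ x, ∫ y, f y ∂(K x) ∂π = ∫ x, f x ∂π

theorem Preserves.pow {K : Kernel E E} [IsMarkovKernel K] {π : Measure E}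
    (h : Preserves K π) (n : ℕ) : Preserves (K ^ n) π := by
  induction n with
  | zero => intro f hf; simp_rw [integral_pow_zero K hf]
  | succ n ih =>
    intro f hf
    simp_rw [integral_pow_succ K hf]
    rw [h _ (hf.integral_kernel (K ^ n)), ih f hf]

/-- The operator inequality `c Q ≤ K`, in terms of test functions. -/
def Minorises (c : ℝ) (Q K : Kernel E E) : Prop :=
  ∀ f, UnitValued f → ∀ x, c * ∫ y, f y ∂(Q x) ≤ ∫ y, f y ∂(K x)

theorem Minorises.pow {c : ℝ} (hc : 0 ≤ c) {Q K : Kernel E E} [IsMarkovKernel Q]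
    [IsMarkovKernel K] (h : Minorises c Q K) (n : ℕ) : Minorises (c ^ n) (Q ^ n) (K ^ n) := by
  induction n with
  | zero => intro f hf x; rw [integral_pow_zero K hf, integral_pow_zero Q hf]; simp
  | succ n ih =>
    intro f hf x
    rw [integral_pow_succ K hf, integral_pow_succ Q hf, pow_succ', mul_assoc,
      ← integral_const_mul]
    have hQ := hf.integral_kernel (Q ^ n)
    have hK := hf.integral_kernel (K ^ n)
    calc c * ∫ y, c ^ n * ∫ w, f w ∂((Q ^ n) y) ∂(Q x)
        = c ^ n * (c * ∫ y, ∫ w, f w ∂((Q ^ n) y) ∂(Q x)) := by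
          rw [integral_const_mul]; ring
      _ ≤ c ^ n * ∫ y, ∫ w, f w ∂((Q ^ n) y) ∂(K x) :=
          mul_le_mul_of_nonneg_left (h _ hQ x) (pow_nonneg hc n)
      _ = ∫ y, c ^ n * ∫ w, f w ∂((Q ^ n) y) ∂(K x) := by rw [integral_const_mul]
      _ ≤ ∫ y, ∫ w, f w ∂((K ^ n) y) ∂(K x) :=
          integral_mono ((hQ.integrable _).const_mul _) (hK.integrable _) fun y => ih f hf y

/-- Uniform closeness of two kernels on test functions. -/
def Close (r : ℝ) (K L : Kernel E E) : Prop :=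
  ∀ f, UnitValued f → ∀ x, |∫ y, f y ∂(K x) - ∫ y, f y ∂(L x)| ≤ r

/-- Replacing the steps one at a time costs `r` each, because Markov kernels do not increase
sup-distances. -/
theorem Close.pow {r : ℝ} {K L : Kernel E E} [IsMarkovKernel K] [IsMarkovKernel L]
    (h : Close r K L) (n : ℕ) : Close (n * r) (K ^ n) (L ^ n) := by
  induction n with
  | zero => intro f hf x; rw [integral_pow_zero K hf, integral_pow_zero L hf]; simp
  | succ n ih =>
    intro f hf x
    rw [integral_pow_succ K hf, integral_pow_succ L hf]
    have hK := hf.integral_kernel (K ^ n)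
    have hL := hf.integral_kernel (L ^ n)
    refine (abs_sub_le_add_of_le (abs_integral_sub_integral_le (K x) hK hL fun y => ih f hf y)
      (h _ hL x)).trans (le_of_eq ?_)
    push_cast
    ring

variable {K Q : Kernel E E} [IsMarkovKernel K] [IsMarkovKernel Q] {c : ℝ} {π ν : Measure E}

theorem Minorises.le_one (h : Minorises c Q K) (x : E) : c ≤ 1 := by
  have := h (fun _ => 1) ⟨measurable_const, fun _ => zero_le_one, fun _ => le_rfl⟩ x
  simpa using this

/-- Domination applied to `f` bounds `K f` from below, and applied to `1 - f` bounds it from above.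
The interval has length `1 - c` plus the error `c / 4` on either side. -/
theorem Minorises.exists_range_subset_Icc [IsProbabilityMeasure ν] (hc : 0 ≤ c)
    (hmin : Minorises c Q K) (hν : ∀ f, UnitValued f → ∀ x, |∫ y, f y ∂(Q x) - ∫ y, f y ∂ν| ≤ 1 / 4)
    {f : E → ℝ} (hf : UnitValued f) :
    ∃ b : ℝ, ∀ x, b ≤ ∫ y, f y ∂(K x) ∧ ∫ y, f y ∂(K x) ≤ b + (1 - c / 2) := by
  refine ⟨c * ∫ y, f y ∂ν - c / 4, fun x => ?_⟩
  have h1 := hmin f hf x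
  have h2 := hmin _ hf.one_sub x
  rw [hf.integral_one_sub, hf.integral_one_sub] at h2
  obtain ⟨h3, h4⟩ := abs_le.1 (hν f hf x)
  have h5 := mul_le_mul_of_nonneg_left h3 hc
  have h6 := mul_le_mul_of_nonneg_left h4 hc
  constructor <;> linarith

theorem Minorises.exists_range_pow_subset_Icc [IsProbabilityMeasure ν] (hc : 0 ≤ c)
    (hmin : Minorises c Q K) (hν : ∀ f, UnitValued f → ∀ x, |∫ y, f y ∂(Q x) - ∫ y, f y ∂ν| ≤ 1 / 4)
    {f : E → ℝ} (hf : UnitValued f) (n : ℕ) :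
    ∃ b : ℝ, ∀ x, b ≤ ∫ y, f y ∂((K ^ n) x) ∧ ∫ y, f y ∂((K ^ n) x) ≤ b + (1 - c / 2) ^ n := by
  rcases isEmpty_or_nonempty E with hE | ⟨⟨x₀⟩⟩
  · exact ⟨0, fun x => hE.elim x⟩
  -- `c ≤ 1` needs a point of `E`, hence the separate empty case.
  have hr : 0 < 1 - c / 2 := by linarith [hmin.le_one x₀]
  induction n with
  | zero => exact ⟨0, fun x => by
      rw [integral_pow_zero K hf]; simpa using ⟨hf.nonneg x, hf.le_one x⟩⟩
  | succ n ih =>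
    obtain ⟨b, hb⟩ := ih
    have hrn := pow_pos hr n
    -- Rescaling the range of `K ^ n f` to `[0, 1]` allows the one-step contraction to be applied
    -- again.
    have hg : UnitValued (fun x => (∫ y, f y ∂((K ^ n) x) - b) / (1 - c / 2) ^ n) :=
      ⟨((hf.integral_kernel (K ^ n)).measurable.sub_const b).div_const _,
        fun x => div_nonneg (sub_nonneg.2 (hb x).1) hrn.le,
        fun x => (div_le_one hrn).2 (by linarith [(hb x).2])⟩
    obtain ⟨b', hb'⟩ := hmin.exists_range_subset_Icc hc hν hg
    refine ⟨b + (1 - c / 2) ^ n * b', fun x => ?_⟩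
    have hx : ∫ y, f y ∂((K ^ (n + 1)) x) = b + (1 - c / 2) ^ n *
        ∫ y, (∫ w, f w ∂((K ^ n) y) - b) / (1 - c / 2) ^ n ∂(K x) := by
      rw [integral_pow_succ K hf, integral_div, mul_div_cancel₀ _ hrn.ne',
        integral_sub ((hf.integral_kernel (K ^ n)).integrable _) (integrable_const _)]
      simp
    have h1 := mul_le_mul_of_nonneg_left (hb' x).1 hrn.le
    have h2 := mul_le_mul_of_nonneg_left (hb' x).2 hrn.le
    rw [hx, pow_succ]
    constructor <;> linarith

/-- Geometric convergence of a kernel that dominates a multiple of an almost constant kernel. -/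
theorem Minorises.abs_integral_pow_sub_le [IsProbabilityMeasure ν] [IsProbabilityMeasure π]
    (hc : 0 ≤ c) (hmin : Minorises c Q K)
    (hν : ∀ f, UnitValued f → ∀ x, |∫ y, f y ∂(Q x) - ∫ y, f y ∂ν| ≤ 1 / 4)
    (hπ : Preserves K π) {f : E → ℝ} (hf : UnitValued f) (n : ℕ) (x : E) :
    |∫ y, f y ∂((K ^ n) x) - ∫ y, f y ∂π| ≤ (1 - c / 2) ^ n := by
  obtain ⟨b, hb⟩ := hmin.exists_range_pow_subset_Icc hc hν hf n
  have hK := (hf.integral_kernel (K ^ n)).integrable π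
  -- By invariance the `π`-mean of `f` is an average of `K ^ n f`, so it lies in the same short
  -- interval; `ν` need not equal `π`.
  have h1 : b ≤ ∫ y, f y ∂π := by
    rw [← hπ.pow n f hf]
    simpa using integral_mono (integrable_const b) hK fun y => (hb y).1
  have h2 : ∫ y, f y ∂π ≤ b + (1 - c / 2) ^ n := by
    rw [← hπ.pow n f hf]
    simpa using integral_mono hK (integrable_const (b + (1 - c / 2) ^ n)) fun y => (hb y).2
  rw [abs_le]
  constructor <;> linarith [(hb x).1, (hb x).2]

/-- From any starting point, `K ^ n (K f)` and `K ^ (n + 1) f` coincide, while their limits are the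
two sides of the invariance identity. -/
theorem UniformlyErgodic.preserves [Nonempty E] [IsProbabilityMeasure π]
    (h : UniformlyErgodic K π) : Preserves K π := by
  obtain ⟨M, ρ, h0, h1, h⟩ := h
  intro f hf
  have hlim {g : E → ℝ} (hg : UnitValued g) (x : E) :
      Tendsto (fun n => ∫ y, g y ∂((K ^ n) x)) atTop (𝓝 (∫ y, g y ∂π)) := by
    rw [tendsto_iff_dist_tendsto_zero]
    refine squeeze_zero (fun _ => dist_nonneg)
      (fun n => (abs_integral_sub_le_tvDist _ _ hg).trans (h x n)) ?_
    simpa using (tendsto_pow_atTop_nhds_zero_of_lt_one h0 h1).const_mul M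
  obtain ⟨x⟩ := ‹Nonempty E›
  refine tendsto_nhds_unique (hlim (hf.integral_kernel K) x) ?_
  refine ((tendsto_add_atTop_iff_nat 1).2 (hlim hf x)).congr fun n => ?_
  rw [integral_pow_add K hf, pow_one]

end Kernels

end General

/-! ### Splitting off one coordinate. -/

section Product

variable {d : ℕ} {X : Fin d → Type u}

theorem dropCoord_update (i : Fin d) (x : ∀ j, X j) (y : X i) :
    dropCoord i (Function.update x i y) = dropCoord i x :=
  funext fun j => Function.update_of_ne j.2 _ _

/-- The point of the product with `i`-th coordinate `y` and remaining coordinates `z`. -/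
def insertCoord (i : Fin d) (z : Others X i) (y : X i) : ∀ j, X j :=
  (Equiv.piSplitAt i X).symm (y, z)

theorem insertCoord_apply_self (i : Fin d) (z : Others X i) (y : X i) :
    insertCoord i z y i = y :=
  congrArg Prod.fst ((Equiv.piSplitAt i X).apply_symm_apply (y, z))

theorem dropCoord_insertCoord (i : Fin d) (z : Others X i) (y : X i) :
    dropCoord i (insertCoord i z y) = z :=
  congrArg Prod.snd ((Equiv.piSplitAt i X).apply_symm_apply (y, z))

theorem insertCoord_dropCoord (i : Fin d) (x : ∀ j, X j) :
    insertCoord i (dropCoord i x) (x i) = x :=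
  (Equiv.piSplitAt i X).symm_apply_apply x

theorem update_insertCoord (i : Fin d) (z : Others X i) (y y' : X i) :
    Function.update (insertCoord i z y) i y' = insertCoord i z y' := by
  rw [← insertCoord_dropCoord i (Function.update (insertCoord i z y) i y'), dropCoord_update,
    dropCoord_insertCoord, Function.update_self]

variable [∀ i, MeasurableSpace (X i)]

theorem integral_updateCoord (i : Fin d) (K : Kernel (∀ j, X j) (X i)) [IsMarkovKernel K]
    {f : (∀ j, X j) → ℝ} (hf : UnitValued f) (x : ∀ j, X j) :
    ∫ y, f y ∂(updateCoord i K x) = ∫ y, f (Function.update x i y) ∂(K x) := by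
  rw [updateCoord, Kernel.map_apply _ measurable_update', Kernel.prod_apply, Kernel.id_apply,
    Measure.dirac_prod, integral_map measurable_update'.aemeasurable
      hf.measurable.aestronglyMeasurable, integral_map measurable_prodMk_left.aemeasurable]
  exact (hf.measurable.comp measurable_update').aestronglyMeasurable

theorem measurable_insertCoord (i : Fin d) :
    Measurable (fun w : Others X i × X i => insertCoord i w.1 w.2) := by
  refine measurable_pi_lambda _ fun j => ?_
  by_cases h : j = i
  · subst h
    simp_rw [insertCoord_apply_self]
    exact measurable_snd
  · have (w : Others X i × X i) : insertCoord i w.1 w.2 j = w.1 ⟨j, h⟩ :=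
      congrFun (dropCoord_insertCoord i w.1 w.2) ⟨j, h⟩
    simp_rw [this]
    exact (measurable_pi_apply _).comp measurable_fst

end Product

/-! ### Mixtures of kernels and their dependence on the weights. -/

section Mixture

variable {d : ℕ} {ε : ℝ} {E : Type*} [MeasurableSpace E]

theorem selectionSet_nonneg (α : selectionSet d ε) (i : Fin d) : 0 ≤ (α : Fin d → ℝ) i :=
  α.2.2.1 i

theorem selectionSet_sum (α : selectionSet d ε) : ∑ i, (α : Fin d → ℝ) i = 1 :=
  α.2.2.2

theorem le_selectionSet (α : selectionSet d ε) (i : Fin d) : ε ≤ (α : Fin d → ℝ) i :=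
  (α.2.1 i).1

theorem abs_sum_selectionSet_mul_sub_le (α : selectionSet d ε) {a b : Fin d → ℝ} {r : ℝ}
    (h : ∀ i, |a i - b i| ≤ r) :
    |∑ i, (α : Fin d → ℝ) i * a i - ∑ i, (α : Fin d → ℝ) i * b i| ≤ r := by
  rw [← Finset.sum_sub_distrib]
  calc |∑ i, ((α : Fin d → ℝ) i * a i - (α : Fin d → ℝ) i * b i)|
      ≤ ∑ i, |(α : Fin d → ℝ) i * a i - (α : Fin d → ℝ) i * b i| :=
        Finset.abs_sum_le_sum_abs _ _
    _ ≤ ∑ i, (α : Fin d → ℝ) i * r := Finset.sum_le_sum fun i _ => by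
        rw [← mul_sub, abs_mul, abs_of_nonneg (selectionSet_nonneg α i)]
        exact mul_le_mul_of_nonneg_left (h i) (selectionSet_nonneg α i)
    _ = r := by rw [← Finset.sum_mul, selectionSet_sum, one_mul]

variable (P : Fin d → Kernel E E) [∀ i, IsMarkovKernel (P i)]

theorem integral_mixture {f : E → ℝ} (hf : UnitValued f) (w : selectionSet d ε × E) :
    ∫ y, f y ∂(mixture P w) = ∑ i, (w.1 : Fin d → ℝ) i * ∫ y, f y ∂(P i w.2) := by
  rw [mixture, sum_apply, integral_finsetSum_measure]
  · refine Finset.sum_congr rfl fun i _ => ?_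
    rw [weighted_apply, integral_smul_measure, ENNReal.toReal_ofReal (selectionSet_nonneg _ i),
      smul_eq_mul]
  · intro i _
    rw [weighted_apply]
    exact (hf.integrable _).smul_measure ENNReal.ofReal_ne_top

theorem abs_integral_mixture_sub_le {f : E → ℝ} (hf : UnitValued f) (α α' : selectionSet d ε)
    (x : E) : |∫ y, f y ∂(mixture P (α, x)) - ∫ y, f y ∂(mixture P (α', x))| ≤
      d * ‖(α : Fin d → ℝ) - (α' : Fin d → ℝ)‖ := by
  rw [integral_mixture P hf, integral_mixture P hf, ← Finset.sum_sub_distrib]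
  refine (Finset.abs_sum_le_sum_abs _ _).trans ?_
  have h (i : Fin d) : |(α : Fin d → ℝ) i * ∫ y, f y ∂(P i x) -
      (α' : Fin d → ℝ) i * ∫ y, f y ∂(P i x)| ≤ ‖(α : Fin d → ℝ) - (α' : Fin d → ℝ)‖ := by
    rw [← sub_mul, abs_mul, abs_of_nonneg (hf.integral_nonneg _)]
    exact (mul_le_of_le_one_right (abs_nonneg _) (hf.integral_le_one _)).trans
      (norm_le_pi_norm ((α : Fin d → ℝ) - (α' : Fin d → ℝ)) i)
  simpa using Finset.sum_le_sum fun i (_ : i ∈ Finset.univ) => h i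

instance isMarkovKernel_randomScan (α : selectionSet d ε) : IsMarkovKernel (randomScan P α) := by
  unfold randomScan; infer_instance

theorem integral_randomScan {f : E → ℝ} (hf : UnitValued f) (α : selectionSet d ε) (x : E) :
    ∫ y, f y ∂(randomScan P α x) = ∑ i, (α : Fin d → ℝ) i * ∫ y, f y ∂(P i x) :=
  integral_mixture P hf (α, x)

variable {P}

theorem Close.randomScan {Q : Fin d → Kernel E E} [∀ i, IsMarkovKernel (Q i)] {r : ℝ}
    (h : ∀ i, Close r (P i) (Q i)) (α : selectionSet d ε) :
    Close r (randomScan P α) (randomScan Q α) := by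
  intro f hf x
  rw [integral_randomScan P hf, integral_randomScan Q hf]
  exact abs_sum_selectionSet_mul_sub_le α fun i => h i f hf x

theorem Preserves.randomScan {π : Measure E} [IsFiniteMeasure π] (h : ∀ i, Preserves (P i) π)
    (α : selectionSet d ε) : Preserves (randomScan P α) π := by
  intro f hf
  simp_rw [integral_randomScan P hf]
  rw [integral_finsetSum _ fun i _ => ((hf.integral_kernel (P i)).integrable π).const_mul _]
  simp_rw [integral_const_mul, h _ f hf]
  rw [← Finset.sum_mul, selectionSet_sum, one_mul]

/-- The lower bound `ε` on the selection probabilities enters the argument here. -/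
theorem minorises_randomScan (α : selectionSet d ε) (i : Fin d) :
    Minorises ε (P i) (randomScan P α) := by
  intro f hf x
  rw [integral_randomScan P hf]
  refine (mul_le_mul_of_nonneg_right (le_selectionSet α i) (hf.integral_nonneg _)).trans ?_
  exact Finset.single_le_sum (f := fun i => (α : Fin d → ℝ) i * ∫ y, f y ∂(P i x))
    (fun j _ => mul_nonneg (selectionSet_nonneg α j) (hf.integral_nonneg _)) (Finset.mem_univ i)

/-- Choosing coordinate `i` all `N` times gives domination of `ε ^ N` times `P i ^ N`; averaging
over `i` with weights `β` relates an arbitrary `α` to the one `β` known to be good. -/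
theorem minorises_randomScan_pow (hε : 0 ≤ ε) (α β : selectionSet d ε) (N : ℕ) :
    Minorises (ε ^ N) (randomScan (fun i => P i ^ N) β) (randomScan P α ^ N) := by
  intro f hf x
  rw [integral_randomScan _ hf, Finset.mul_sum]
  calc ∑ i, ε ^ N * ((β : Fin d → ℝ) i * ∫ y, f y ∂((P i ^ N) x))
      ≤ ∑ i, (β : Fin d → ℝ) i * ∫ y, f y ∂((randomScan P α ^ N) x) :=
        Finset.sum_le_sum fun i _ => by
          rw [mul_left_comm]
          exact mul_le_mul_of_nonneg_left ((minorises_randomScan α i).pow hε N f hf x)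
            (selectionSet_nonneg β i)
    _ = ∫ y, f y ∂((randomScan P α ^ N) x) := by rw [← Finset.sum_mul, selectionSet_sum, one_mul]

end Mixture

/-! ### Metropolis updates against Gibbs updates; uniform convergence of the random scan. -/

namespace Setting

variable {d : ℕ} {X : Fin d → Type u} [∀ i, MeasurableSpace (X i)] (S : Setting X)

instance isMarkovKernel_metropolisAt (i : Fin d) (z : Others X i) :
    IsMarkovKernel (S.metropolisAt i z) := by
  unfold metropolisAt; infer_instance

theorem integral_gibbsStep (i : Fin d) {f : (∀ j, X j) → ℝ} (hf : UnitValued f) (x : ∀ j, X j) :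
    ∫ y, f y ∂(S.gibbsStep i x) =
      ∫ y, f (Function.update x i y) ∂(S.cond i (dropCoord i x)) :=
  integral_updateCoord i _ hf x

theorem integral_metropolisStep (i : Fin d) {f : (∀ j, X j) → ℝ} (hf : UnitValued f)
    (x : ∀ j, X j) : ∫ y, f y ∂(S.metropolisStep i x) =
      ∫ y, f (Function.update x i y) ∂(S.metropolisAt i (dropCoord i x) (x i)) :=
  integral_updateCoord i _ hf x

/-- Updates of coordinate `i` leave `x_{-i}` unchanged, so all `N` of them use the same kernel on `X
i`. -/
theorem integral_metropolisStep_pow (i : Fin d) (N : ℕ) {f : (∀ j, X j) → ℝ} (hf : UnitValued f)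
    (x : ∀ j, X j) : ∫ y, f y ∂((S.metropolisStep i ^ N) x) =
      ∫ y, f (Function.update x i y) ∂((S.metropolisAt i (dropCoord i x) ^ N) (x i)) := by
  induction N generalizing x with
  | zero =>
    rw [integral_pow_zero _ hf, integral_pow_zero _ (hf.comp (measurable_update x)),
      Function.update_eq_self]
  | succ N ih =>
    rw [integral_pow_succ _ hf, integral_pow_succ _ (hf.comp (measurable_update x)),
      S.integral_metropolisStep i (hf.integral_kernel _)]
    simp_rw [ih, dropCoord_update, Function.update_self, Function.update_idem]

theorem nonempty (S : Setting X) : Nonempty (∀ j, X j) :=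
  nonempty_of_isProbabilityMeasure S.target

/-- Disintegration of the target along `x_{-i}`; it reduces invariance on the product to invariance
on each fibre. -/
theorem integral_target (i : Fin d) {f : (∀ j, X j) → ℝ} (hf : UnitValued f) :
    ∫ x, f x ∂S.target = ∫ z, ∫ y, f (insertCoord i z y) ∂(S.cond i z)
      ∂(S.target.map (fun x => (dropCoord i x, x i))).fst := by
  have hm : Measurable (fun x : ∀ j, X j => (dropCoord i x, x i)) :=
    (measurable_dropCoord i).prodMk (measurable_pi_apply i)
  have : IsProbabilityMeasure (S.target.map (fun x => (dropCoord i x, x i))) :=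
    Measure.isProbabilityMeasure_map hm.aemeasurable
  have hdis : (S.target.map (fun x => (dropCoord i x, x i))).fst ⊗ₘ S.cond i =
      S.target.map (fun x => (dropCoord i x, x i)) := (S.isCondKernel i).disintegrate
  have hg := hf.comp (measurable_insertCoord (X := X) i)
  rw [← Measure.integral_compProd (f := fun w => f (insertCoord i w.1 w.2)) (hg.integrable _),
    hdis, integral_map hm.aemeasurable hg.measurable.aestronglyMeasurable]
  simp_rw [insertCoord_dropCoord]

theorem preserves_metropolisStep (i : Fin d)
    (h : ∀ z, Preserves (S.metropolisAt i z) (S.cond i z)) :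
    Preserves (S.metropolisStep i) S.target := by
  intro f hf
  rw [S.integral_target i (hf.integral_kernel _), S.integral_target i hf]
  simp_rw [S.integral_metropolisStep i hf, dropCoord_insertCoord, insertCoord_apply_self,
    update_insertCoord]
  refine integral_congr_ae (ae_of_all _ fun z => ?_)
  exact h z _ (hf.comp ((measurable_insertCoord i).comp measurable_prodMk_left))

theorem close_metropolisStep_pow_gibbsStep (i : Fin d) {N : ℕ} {r : ℝ}
    (h : ∀ z f, UnitValued f → ∀ x,
      |∫ y, f y ∂((S.metropolisAt i z ^ N) x) - ∫ y, f y ∂(S.cond i z)| ≤ r) :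
    Close r (S.metropolisStep i ^ N) (S.gibbsStep i) := by
  intro f hf x
  rw [S.integral_metropolisStep_pow i N hf, S.integral_gibbsStep i hf]
  exact h _ _ (hf.comp (measurable_update x)) _

variable {S}

/-- Invariance comes from the assumed ergodicity, with no detailed balance computation. -/
theorem MetropolisMinorised.preserves (hc : S.MetropolisMinorised) (i : Fin d)
    (z : Others X i) : Preserves (S.metropolisAt i z) (S.cond i z) :=
  have : Nonempty (X i) := S.nonempty.map fun x => x i
  ((hc i).1 z).preserves

/-- The ergodicity constants may vary with `z`. Uniformity comes from the minorisation, which yields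
the rate `1 - s / 2` per `m` steps. -/
theorem MetropolisMinorised.eventually_close (hc : S.MetropolisMinorised) (i : Fin d) {r : ℝ}
    (hr : 0 < r) : ∀ᶠ N in atTop, ∀ z f, UnitValued f → ∀ x,
      |∫ y, f y ∂((S.metropolisAt i z ^ N) x) - ∫ y, f y ∂(S.cond i z)| ≤ r := by
  obtain ⟨s, m, hs, hmin⟩ := (hc i).2
  obtain ⟨x₀⟩ := S.nonempty
  have hs0 : (0 : ℝ) < s := hs
  choose ν hν hle using hmin
  have hminor (z : Others X i) :
      Minorises (s : ℝ) (Kernel.const (X i) (ν z)) (S.metropolisAt i z ^ m) := by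
    intro f hf x
    have := hν z
    have h := integral_mono_measure (hle z x) (ae_of_all _ hf.nonneg) (hf.integrable _)
    rwa [integral_smul_nnreal_measure] at h
  have hs1 : (s : ℝ) ≤ 1 := by
    have := hν (dropCoord i x₀)
    exact (hminor (dropCoord i x₀)).le_one (x₀ i)
  obtain ⟨n, hn⟩ := exists_pow_lt_of_lt_one hr (show 1 - (s : ℝ) / 2 < 1 by linarith)
  filter_upwards [eventually_ge_atTop (m * n)] with N hN z f hf x
  have := hν z
  -- The `k` surplus steps run first and only average a bound that holds from every point.
  obtain ⟨k, rfl⟩ := Nat.exists_eq_add_of_le' hN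
  rw [integral_pow_add _ hf]
  refine abs_integral_sub_const_le _ (hf.integral_kernel _) fun y => ?_
  -- The dominated kernel is constant, so its distance from `ν z` is zero.
  rw [pow_mul]
  refine ((hminor z).abs_integral_pow_sub_le (ν := ν z) hs0.le (fun g _ x => ?_)
    ((hc.preserves i z).pow m) hf n y).trans hn.le
  simp

/-- The random scan Metropolis kernels converge to the target uniformly in the starting point and
in the selection probabilities. -/
theorem MetropolisMinorised.exists_pow_randomScan_close (hc : S.MetropolisMinorised) {ε : ℝ}
    (hε : 0 < ε) {β : selectionSet d ε} (hβ : UniformlyErgodic (S.rsg β) S.target) {r : ℝ}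
    (hr : 0 < r) : ∃ K : ℕ, ∀ (α : selectionSet d ε) f, UnitValued f → ∀ x,
      |∫ y, f y ∂((randomScan S.metropolisStep α ^ K) x) - ∫ y, f y ∂S.target| ≤ r := by
  obtain ⟨M, ρ, h0, h1, hM⟩ := hβ
  obtain ⟨k, hk⟩ : ∃ k : ℕ, M * ρ ^ k < 1 / 8 := by
    have h := (tendsto_pow_atTop_nhds_zero_of_lt_one h0 h1).const_mul M
    rw [mul_zero] at h
    exact (h.eventually_lt_const (by norm_num : (0 : ℝ) < 1 / 8)).exists
  -- Over `k` steps this tolerance adds up to at most `1 / 8`, which with the `1 / 8` from RSG(`β`)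
  -- gives the required `1 / 4`; `k + 1` covers `k = 0`.
  have hk8 : (0 : ℝ) < 1 / (8 * (k + 1)) := by positivity
  obtain ⟨N, hN⟩ := (eventually_all.2 fun i => hc.eventually_close i hk8).exists
  have : ∀ α : selectionSet d ε, IsMarkovKernel (S.rsg α) := fun α =>
    isMarkovKernel_randomScan _ α
  have hclose := (Close.randomScan
    (fun i => S.close_metropolisStep_pow_gibbsStep i (hN i)) β).pow k
  have hnear (f : (∀ j, X j) → ℝ) (hf : UnitValued f) (x : ∀ j, X j) :
      |∫ y, f y ∂((randomScan (fun i => S.metropolisStep i ^ N) β ^ k) x) -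
        ∫ y, f y ∂S.target| ≤ 1 / 4 := by
    have h2 := (abs_integral_sub_le_tvDist ((S.rsg β ^ k) x) S.target hf).trans (hM x k)
    refine (abs_sub_le_add_of_le (hclose f hf x) h2).trans ?_
    have h3 : (k : ℝ) * (1 / (8 * (k + 1))) ≤ 1 / 8 := by
      rw [mul_one_div, div_le_div_iff₀ (by positivity) (by norm_num)]
      linarith
    linarith
  have hminor (α : selectionSet d ε) :=
    (minorises_randomScan_pow (P := S.metropolisStep) hε.le α β N).pow (pow_nonneg hε.le N) k
  have hpos : 0 < (ε ^ N) ^ k := by positivity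
  -- The contraction constant involves `ε`, `N` and `k` only, so `n` serves all `α`.
  obtain ⟨n, hn⟩ := exists_pow_lt_of_lt_one hr (show 1 - (ε ^ N) ^ k / 2 < 1 by linarith)
  refine ⟨N * k * n, fun α f hf x => ?_⟩
  rw [pow_mul, pow_mul]
  exact ((hminor α).abs_integral_pow_sub_le hpos.le hnear
    (((Preserves.randomScan (fun i => S.preserves_metropolisStep i (hc.preserves i)) α).pow
      N).pow k) hf n x).trans hn.le

end Setting

/-! ### The chain with frozen selection probabilities. -/

section FrozenSelection

variable {d : ℕ} {ε : ℝ} {E : Type*} [MeasurableSpace E] (P : Fin d → Kernel E E)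
  [∀ i, IsMarkovKernel (P i)]

/-- The expectation of `f` after `m` steps of the random scan from `w.2` with fixed selection
probabilities `w.1`. -/
noncomputable def frozenExpectation (f : E → ℝ) (m : ℕ) (w : selectionSet d ε × E) : ℝ :=
  ∫ y, f y ∂((randomScan P w.1 ^ m) w.2)

variable {f : E → ℝ}

theorem frozenExpectation_zero (hf : UnitValued f) (w : selectionSet d ε × E) :
    frozenExpectation P f 0 w = f w.2 :=
  integral_pow_zero _ hf _

theorem frozenExpectation_succ (hf : UnitValued f) (m : ℕ) (w : selectionSet d ε × E) :
    frozenExpectation P f (m + 1) w = ∫ y, frozenExpectation P f m (w.1, y) ∂(mixture P w) :=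
  integral_pow_succ _ hf m _

/-- Joint measurability in `(α, x)` is the point: the powers are formed for each `α` separately, but
the recursion goes through the jointly measurable `mixture`. -/
theorem UnitValued.frozenExpectation (hf : UnitValued f) (m : ℕ) :
    UnitValued (frozenExpectation (ε := ε) P f m) := by
  induction m with
  | zero =>
    rw [funext (frozenExpectation_zero P hf)]
    exact hf.comp measurable_snd
  | succ m ih =>
    rw [funext (frozenExpectation_succ P hf m)]
    exact UnitValued.integral_kernel_prod
      (g := fun v : (selectionSet d ε × E) × E => AdaptiveGibbs.frozenExpectation P f m (v.1.1, v.2))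
      (ih.comp (by fun_prop)) (mixture P)

end FrozenSelection

/-! ### Distances between selection probabilities. -/

section SelectionDistance

variable {d : ℕ} {ε : ℝ}

theorem norm_selectionSet_sub_le_one (α α' : selectionSet d ε) :
    ‖(α : Fin d → ℝ) - (α' : Fin d → ℝ)‖ ≤ 1 := by
  refine (pi_norm_le_iff_of_nonneg zero_le_one).2 fun i => ?_
  have h1 := (α.2.1 i).2
  have h2 := (α'.2.1 i).2
  have h3 := selectionSet_nonneg α i
  have h4 := selectionSet_nonneg α' i
  rw [Pi.sub_apply, Real.norm_eq_abs, abs_le]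
  constructor <;> linarith

theorem UnitValued.norm_selectionSet_sub {E : Type*} [MeasurableSpace E]
    {a b : E → selectionSet d ε} (ha : Measurable a) (hb : Measurable b) :
    UnitValued (fun x => ‖(a x : Fin d → ℝ) - (b x : Fin d → ℝ)‖) :=
  ⟨((measurable_subtype_coe.comp ha).sub (measurable_subtype_coe.comp hb)).norm,
    fun _ => norm_nonneg _, fun _ => norm_selectionSet_sub_le_one _ _⟩

theorem Setting.norm_sub_le_sum_increment {X : Fin d → Type u}
    (ω : ℕ → selectionSet d ε × (∀ j, X j)) (n j : ℕ) :
    ‖((ω (n + j)).1 : Fin d → ℝ) - ((ω n).1 : Fin d → ℝ)‖ ≤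
      ∑ l ∈ Finset.range j, Setting.increment (n + l) ω := by
  rw [← dist_eq_norm, dist_comm]
  refine dist_le_range_sum_of_dist_le (f := fun j => ((ω (n + j)).1 : Fin d → ℝ)) j fun {k} _ => ?_
  rw [dist_comm, dist_eq_norm]
  exact le_rfl

end SelectionDistance

/-! ### The adaptive chain compared with the frozen chain. -/

namespace Setting

variable {d : ℕ} {X : Fin d → Type u} [∀ i, MeasurableSpace (X i)] (S : Setting X)
  {ε : ℝ} (R : UpdateRule ε X)

instance isProbabilityMeasure_adapLaw (x₀ : ∀ j, X j) (α₀ : selectionSet d ε) :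
    IsProbabilityMeasure (S.adapLaw R x₀ α₀) := by
  unfold adapLaw; infer_instance

theorem integral_adapStep (n : ℕ) (h : History ε X n) {g : selectionSet d ε × (∀ j, X j) → ℝ}
    (hg : UnitValued g) : ∫ w, g w ∂(S.adapStep R n h) =
      ∫ y, g (R.toFun n h, y) ∂(mixture S.metropolisStep
        (R.toFun n h, (h ⟨n, Finset.mem_Iic.2 le_rfl⟩).2)) := by
  rw [adapStep, Kernel.comap_apply, Kernel.prod_apply, Kernel.deterministic_apply,
    Measure.dirac_prod, integral_map measurable_prodMk_left.aemeasurable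
      hg.measurable.aestronglyMeasurable]

/-- The Markov property of the adaptive sampler at time `n`. -/
theorem integral_adapLaw_succ (x₀ : ∀ j, X j) (α₀ : selectionSet d ε) (n : ℕ)
    {g : History ε X n × (selectionSet d ε × (∀ j, X j)) → ℝ} (hg : UnitValued g) :
    ∫ ω, g (Preorder.frestrictLe n ω, ω (n + 1)) ∂(S.adapLaw R x₀ α₀) =
      ∫ ω, ∫ y, g (Preorder.frestrictLe n ω, (R.toFun n (Preorder.frestrictLe n ω), y))
        ∂(mixture S.metropolisStep (R.toFun n (Preorder.frestrictLe n ω), (ω n).2))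
        ∂(S.adapLaw R x₀ α₀) := by
  have hmeas : Measurable (fun ω : ℕ → selectionSet d ε × (∀ j, X j) =>
      ((Preorder.frestrictLe n ω : History ε X n), ω (n + 1))) := by fun_prop
  have hker := (hg.integral_kernel_prod (S.adapStep R n)).measurable.aestronglyMeasurable
    (μ := (S.adapLaw R x₀ α₀).map (Preorder.frestrictLe n))
  -- The joint law of the history and the next state is the composition-product of the history's law
  -- with the step kernel.
  have key := Kernel.partialTraj_compProd_eq_map_traj
    (X := fun _ => selectionSet d ε × (∀ j, X j)) (κ := S.adapStep R) (zero_le : 0 ≤ n)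
    (x₀ := fun _ => (α₀, x₀))
  rw [← integral_map (φ := fun ω : ℕ → selectionSet d ε × (∀ j, X j) =>
    ((Preorder.frestrictLe n ω : History ε X n), ω (n + 1))) hmeas.aemeasurable
    hg.measurable.aestronglyMeasurable]
  unfold adapLaw at hker ⊢
  rw [← key, Measure.integral_compProd (hg.integrable _),
    ← Kernel.traj_map_frestrictLe_apply, integral_map (by fun_prop) hker]
  refine integral_congr_ae (ae_of_all _ fun ω => ?_)
  exact S.integral_adapStep R n _ (hg.comp measurable_prodMk_left)

/-- Given the history up to `n + j`, the two integrands differ in a single move, made with `α_n` in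
one and with `α_{n+j+1}` in the other. -/
theorem abs_frozen_step_le (x₀ : ∀ j, X j) (α₀ : selectionSet d ε) (n j m : ℕ)
    {f : (∀ j, X j) → ℝ} (hf : UnitValued f) :
    |∫ ω, frozenExpectation S.metropolisStep f (m + 1) ((ω n).1, (ω (n + j)).2)
        ∂(S.adapLaw R x₀ α₀) -
      ∫ ω, frozenExpectation S.metropolisStep f m ((ω n).1, (ω (n + j + 1)).2)
        ∂(S.adapLaw R x₀ α₀)| ≤
      d * ∫ ω, ‖((ω (n + j + 1)).1 : Fin d → ℝ) - ((ω n).1 : Fin d → ℝ)‖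
        ∂(S.adapLaw R x₀ α₀) := by
  have hn : n ∈ Finset.Iic (n + j) := Finset.mem_Iic.2 (Nat.le_add_right n j)
  have hF (k : ℕ) := hf.frozenExpectation (ε := ε) S.metropolisStep k
  have h1 := S.integral_adapLaw_succ R x₀ α₀ (n + j)
    (g := fun v => frozenExpectation S.metropolisStep f m ((v.1 ⟨n, hn⟩).1, v.2.2))
    ((hF m).comp (by fun_prop))
  -- Along a trajectory, `α_{n+j+1}` is the value of the update rule only almost surely; the Markov
  -- property makes the substitution under the integral.
  have h2 := S.integral_adapLaw_succ R x₀ α₀ (n + j)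
    (g := fun v => ‖(v.2.1 : Fin d → ℝ) - ((v.1 ⟨n, hn⟩).1 : Fin d → ℝ)‖)
    (UnitValued.norm_selectionSet_sub (by fun_prop) (by fun_prop))
  simp only [Preorder.frestrictLe_apply, integral_const, probReal_univ, one_smul] at h1 h2
  rw [h1, h2, ← integral_const_mul]
  have hR : Measurable fun ω : ℕ → selectionSet d ε × (∀ j, X j) =>
      R.toFun (n + j) (Preorder.frestrictLe (n + j) ω) :=
    (R.measurable_toFun _).comp (Preorder.measurable_frestrictLe _)
  have hleft : UnitValued fun ω : ℕ → selectionSet d ε × (∀ j, X j) =>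
      frozenExpectation S.metropolisStep f (m + 1) ((ω n).1, (ω (n + j)).2) :=
    (hF (m + 1)).comp (by fun_prop)
  have hright : UnitValued fun ω : ℕ → selectionSet d ε × (∀ j, X j) =>
      ∫ y, frozenExpectation S.metropolisStep f m ((ω n).1, y) ∂(mixture S.metropolisStep
        (R.toFun (n + j) (Preorder.frestrictLe (n + j) ω), (ω (n + j)).2)) :=
    UnitValued.integral_kernel_prod
      (g := fun v : (ℕ → selectionSet d ε × (∀ j, X j)) × (∀ j, X j) =>
        frozenExpectation S.metropolisStep f m ((v.1 n).1, v.2)) ((hF m).comp (by fun_prop))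
      ((mixture S.metropolisStep).comap (fun ω : ℕ → selectionSet d ε × (∀ j, X j) =>
        (R.toFun (n + j) (Preorder.frestrictLe (n + j) ω), (ω (n + j)).2))
        (hR.prodMk (by fun_prop)))
  rw [← integral_sub (hleft.integrable _) (hright.integrable _), ← Real.norm_eq_abs]
  refine norm_integral_le_of_norm_le
    (((UnitValued.norm_selectionSet_sub hR (by fun_prop)).integrable _).const_mul _)
    (ae_of_all _ fun ω => ?_)
  rw [frozenExpectation_succ _ hf, Real.norm_eq_abs, norm_sub_rev]
  exact abs_integral_mixture_sub_le _ ((hF m).comp measurable_prodMk_left) _ _ _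

theorem unitValued_increment (n : ℕ) : UnitValued (increment (X := X) (ε := ε) n) :=
  UnitValued.norm_selectionSet_sub (by fun_prop) (by fun_prop)

/-- Below the threshold the increment is at most `δ`, above it at most `1`. -/
theorem integral_increment_le (x₀ : ∀ j, X j) (α₀ : selectionSet d ε) (n : ℕ) {δ : ℝ}
    (hδ : 0 ≤ δ) :
    ∫ ω, increment n ω ∂(S.adapLaw R x₀ α₀) ≤
      δ + (S.adapLaw R x₀ α₀).real {ω | δ ≤ increment n ω} := by
  have hinc := unitValued_increment (X := X) (ε := ε) n
  have hset : MeasurableSet {ω : ℕ → selectionSet d ε × (∀ j, X j) | δ ≤ increment n ω} :=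
    measurableSet_le measurable_const hinc.measurable
  calc ∫ ω, increment n ω ∂(S.adapLaw R x₀ α₀)
      ≤ ∫ ω, (δ + {ω | δ ≤ increment n ω}.indicator (fun _ => (1 : ℝ)) ω)
          ∂(S.adapLaw R x₀ α₀) := by
        refine integral_mono (hinc.integrable _)
          ((integrable_const δ).add ((UnitValued.indicator hset).integrable _)) fun ω => ?_
        by_cases h : δ ≤ increment n ω
        · simpa [h] using (hinc.le_one ω).trans (le_add_of_nonneg_left hδ)
        · simpa [h] using (not_le.1 h).le
    _ = δ + (S.adapLaw R x₀ α₀).real {ω | δ ≤ increment n ω} := by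
        rw [integral_add (integrable_const δ) ((UnitValued.indicator hset).integrable _),
          integral_indicator_const _ hset]
        simp

/-- Telescoping over `j`: run the adaptive chain to time `n + j`, then `K - j` steps with `α_n`.
Each of the `K` exchanges costs `d` times a drift made of at most `K` increments, each of mean at
most `2 * δ`. -/
theorem abs_integral_sub_frozen_le (x₀ : ∀ j, X j) (α₀ : selectionSet d ε) (n K : ℕ) {δ : ℝ}
    (hδ : 0 ≤ δ)
    (hinc : ∀ l < K, S.adapLaw R x₀ α₀ {ω | δ ≤ increment (n + l) ω} ≤ ENNReal.ofReal δ)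
    {f : (∀ j, X j) → ℝ} (hf : UnitValued f) :
    |∫ ω, frozenExpectation S.metropolisStep f K (ω n) ∂(S.adapLaw R x₀ α₀) -
      ∫ ω, f (ω (n + K)).2 ∂(S.adapLaw R x₀ α₀)| ≤ K * (d * (K * (2 * δ))) := by
  have hdist (j : ℕ) (hj : j < K) :
      ∫ ω, ‖((ω (n + j + 1)).1 : Fin d → ℝ) - ((ω n).1 : Fin d → ℝ)‖ ∂(S.adapLaw R x₀ α₀) ≤
        K * (2 * δ) := by
    have hl (l : ℕ) (hl : l ∈ Finset.range (j + 1)) :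
        ∫ ω, increment (n + l) ω ∂(S.adapLaw R x₀ α₀) ≤ 2 * δ := by
      have h := ENNReal.toReal_le_of_le_ofReal hδ
        (hinc l ((Finset.mem_range_succ_iff.1 hl).trans_lt hj))
      have h' := S.integral_increment_le R x₀ α₀ (n + l) hδ
      rw [measureReal_def] at h'
      linarith
    calc ∫ ω, ‖((ω (n + j + 1)).1 : Fin d → ℝ) - ((ω n).1 : Fin d → ℝ)‖ ∂(S.adapLaw R x₀ α₀)
        ≤ ∫ ω, ∑ l ∈ Finset.range (j + 1), increment (n + l) ω ∂(S.adapLaw R x₀ α₀) :=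
          integral_mono ((UnitValued.norm_selectionSet_sub (by fun_prop)
            (by fun_prop)).integrable _)
            (integrable_finsetSum _ fun l _ => (unitValued_increment (n + l)).integrable _)
            fun ω => norm_sub_le_sum_increment ω n (j + 1)
      _ = ∑ l ∈ Finset.range (j + 1), ∫ ω, increment (n + l) ω ∂(S.adapLaw R x₀ α₀) :=
          integral_finsetSum _ fun l _ => (unitValued_increment (n + l)).integrable _
      _ ≤ ∑ l ∈ Finset.range (j + 1), 2 * δ := Finset.sum_le_sum hl
      _ = ((j + 1 : ℕ) : ℝ) * (2 * δ) := by simp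
      _ ≤ K * (2 * δ) :=
          mul_le_mul_of_nonneg_right (Nat.cast_le.2 hj) (by positivity)
  have htel := dist_le_range_sum_of_dist_le (d := fun _ => (d : ℝ) * (K * (2 * δ)))
    (f := fun j => ∫ ω, frozenExpectation S.metropolisStep f (K - j) ((ω n).1, (ω (n + j)).2)
      ∂(S.adapLaw R x₀ α₀)) K fun {j} hj => by
    obtain ⟨m, rfl⟩ := Nat.exists_eq_add_of_lt hj
    have e1 : j + m + 1 - j = m + 1 := by omega
    have e2 : j + m + 1 - (j + 1) = m := by omega
    rw [Real.dist_eq, e1, e2]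
    exact (S.abs_frozen_step_le R x₀ α₀ n j m hf).trans
      (mul_le_mul_of_nonneg_left (hdist j hj) (Nat.cast_nonneg d))
  simpa [frozenExpectation_zero _ hf, Real.dist_eq] using htel

/-! ### Convergence of the adaptive sampler. -/

variable {S}

/-- Quantitative core of both conclusions: `K` and `δ` are chosen before the starting values and the
time. -/
theorem MetropolisMinorised.exists_tvToTarget_le (hc : S.MetropolisMinorised) (hε : 0 < ε)
    {β : selectionSet d ε} (hβ : UniformlyErgodic (S.rsg β) S.target) {e : ℝ} (he : 0 < e) :
    ∃ (K : ℕ) (δ : ℝ), 0 < δ ∧ ∀ x₀ α₀ n,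
      (∀ l < K, S.adapLaw R x₀ α₀ {ω | δ ≤ increment (n + l) ω} ≤ ENNReal.ofReal δ) →
      S.tvToTarget R x₀ α₀ (n + K) ≤ e := by
  obtain ⟨K, hK⟩ := hc.exists_pow_randomScan_close hε hβ (half_pos he)
  have hpos : (0 : ℝ) < 4 * (K * (d * K)) + 1 := by positivity
  -- This `δ` makes the comparison error `2 * d * K ^ 2 * δ` at most `e / 2`; the `+ 1` keeps the
  -- denominator positive when `K = 0`.
  refine ⟨K, e / (4 * (K * (d * K)) + 1), div_pos he hpos, fun x₀ α₀ n hinc => ?_⟩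
  refine tvDist_le_of_forall_unitValued he.le fun f hf => ?_
  rw [integral_map (show Measurable _ by fun_prop).aemeasurable
    hf.measurable.aestronglyMeasurable]
  have h1 := S.abs_integral_sub_frozen_le R x₀ α₀ n K (div_pos he hpos).le hinc hf
  rw [abs_sub_comm] at h1
  -- The frozen expectation is within `e / 2` of the target mean whatever `(α_n, X_n)` is.
  have h2 := abs_integral_sub_const_le (S.adapLaw R x₀ α₀)
    ((hf.frozenExpectation S.metropolisStep K).comp (measurable_pi_apply n))
    fun ω => hK (ω n).1 f hf (ω n).2
  refine (abs_sub_le_add_of_le h1 h2).trans ?_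
  have h3 : K * (d * (K * (2 * (e / (4 * (K * (d * K)) + 1))))) ≤ e / 2 := by
    rw [show K * (d * (K * (2 * (e / (4 * (K * (d * K)) + 1))))) =
      e * (2 * (K * (d * K))) / (4 * (K * (d * K)) + 1) by ring,
      div_le_div_iff₀ hpos two_pos]
    nlinarith
  linarith

theorem tvToTarget_nonneg (x₀ : ∀ j, X j) (α₀ : selectionSet d ε) (n : ℕ) :
    0 ≤ S.tvToTarget R x₀ α₀ n :=
  tvDist_nonneg _ _

variable {R}

theorem MetropolisMinorised.tendsto_tvToTarget (hc : S.MetropolisMinorised) (hε : 0 < ε)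
    {β : selectionSet d ε} (hβ : UniformlyErgodic (S.rsg β) S.target) {x₀ : ∀ j, X j}
    {α₀ : selectionSet d ε} (hdim : S.DiminishingFrom R x₀ α₀) :
    Tendsto (S.tvToTarget R x₀ α₀) atTop (𝓝 0) := by
  refine tendsto_order.2 ⟨fun a ha => Eventually.of_forall fun n =>
    ha.trans_le (tvToTarget_nonneg R x₀ α₀ n), fun a ha => ?_⟩
  obtain ⟨K, δ, hδ, h⟩ := hc.exists_tvToTarget_le R hε hβ (half_pos ha)
  have hlim := tendstoInMeasure_iff_norm.1 hdim δ hδ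
  obtain ⟨N, hN⟩ := eventually_atTop.1
    (hlim.eventually_le_const (ENNReal.ofReal_pos.2 hδ))
  filter_upwards [eventually_ge_atTop (N + K)] with n hn
  obtain ⟨k, rfl⟩ := Nat.exists_eq_add_of_le' ((Nat.le_add_left K N).trans hn)
  refine (h x₀ α₀ k fun l _ => ?_).trans_lt (half_lt_self ha)
  simpa [Real.norm_of_nonneg ((unitValued_increment _).nonneg _)] using hN (k + l) (by omega)

theorem MetropolisMinorised.tendsto_iSup_tvToTarget (hc : S.MetropolisMinorised) (hε : 0 < ε)
    {β : selectionSet d ε} (hβ : UniformlyErgodic (S.rsg β) S.target)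
    (hdim : S.UniformlyDiminishing R) :
    Tendsto (fun n => ⨆ p : (∀ j, X j) × selectionSet d ε, S.tvToTarget R p.1 p.2 n)
      atTop (𝓝 0) := by
  refine tendsto_order.2 ⟨fun a ha => Eventually.of_forall fun n =>
    ha.trans_le (Real.iSup_nonneg fun p => tvToTarget_nonneg R p.1 p.2 n), fun a ha => ?_⟩
  obtain ⟨K, δ, hδ, h⟩ := hc.exists_tvToTarget_le R hε hβ (half_pos ha)
  have hsmall : ∀ᶠ n in atTop, ∀ x₀ α₀,
      S.adapLaw R x₀ α₀ {ω | δ ≤ increment n ω} ≤ ENNReal.ofReal δ := by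
    filter_upwards [(hdim δ hδ).eventually_le_const (ENNReal.ofReal_pos.2 hδ)] with n hn x₀ α₀
    exact (le_iSup₂ (f := fun x₀ α₀ => S.adapLaw R x₀ α₀ {ω | δ ≤ increment n ω}) x₀ α₀).trans hn
  -- Uniform diminishing gives one `N` for all starting values.
  obtain ⟨N, hN⟩ := eventually_atTop.1 hsmall
  filter_upwards [eventually_ge_atTop (N + K)] with n hn
  obtain ⟨k, rfl⟩ := Nat.exists_eq_add_of_le' ((Nat.le_add_left K N).trans hn)
  have hle (p : (∀ j, X j) × selectionSet d ε) : S.tvToTarget R p.1 p.2 (k + K) ≤ a / 2 :=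
    h p.1 p.2 k fun l _ => hN (k + l) (by omega) p.1 p.2
  exact (Real.iSup_le hle (half_pos ha).le).trans_lt (half_lt_self ha)

end Setting

end AdaptiveGibbs

theorem mainTheorem3 {d : ℕ} (X : Fin d → Type u) [∀ i, MeasurableSpace (X i)]
    (S : AdaptiveGibbs.Setting X) (ε : ℝ) (hε : 0 < ε) (hεd : ε ≤ 1 / (d : ℝ))
    (R : AdaptiveGibbs.UpdateRule ε X)
    (hb : ∃ β : AdaptiveGibbs.selectionSet d ε,
      AdaptiveGibbs.UniformlyErgodic (S.rsg β) S.target)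
    (hc : S.MetropolisMinorised) :
    (∀ x₀ α₀, S.DiminishingFrom R x₀ α₀ → Tendsto (S.tvToTarget R x₀ α₀) atTop (𝓝 0)) ∧
    ((∀ᵐ x₀ ∂S.target, ∀ α₀, S.DiminishingFrom R x₀ α₀) → S.Ergodic R) ∧
    (S.UniformlyDiminishing R →
      Tendsto (fun n => ⨆ p : (∀ j, X j) × AdaptiveGibbs.selectionSet d ε,
        S.tvToTarget R p.1 p.2 n) atTop (𝓝 0)) := by
  obtain ⟨β, hβ⟩ := hb
  refine ⟨fun x₀ α₀ h => hc.tendsto_tvToTarget hε hβ h, fun h => ?_,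
    fun h => hc.tendsto_iSup_tvToTarget hε hβ h⟩
  filter_upwards [h] with x₀ hx α₀
  exact hc.tendsto_tvToTarget hε hβ (hx α₀)
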